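/- An MV-algebra is a system $(A,\oplus,\neg,\bot)$ such that $(A,\oplus,\bot)$ is a commutative monoid, $\neg\neg x=x$, $x\oplus\neg\bot=\neg\bot$ and $\neg(\neg x\oplus y)\oplus y=\neg(\neg y\oplus x)\oplus x$; put $x\to y:=\neg x\oplus y$. The interval $[0,1]$ is an MV-algebra with $x\oplus y=\min\{1,x+y\}$, $\neg x=1-x$, $\bot=0$. An embedding is an injective homomorphism of MV-algebras. For a finite non-empty set $X$ let $\mathrm{Free}(X)$ be the free MV-algebra generated by $X$; each $g\in\mathrm{Free}(X)$ has an associated McNaughton function $f_g:[0,1]^X\to[0,1]$, obtained by evaluating $g$ in $[0,1]$. For $P\subseteq[0,1]^X$ let $\mathrm{Free}(X)/P$ be the quotient of $\mathrm{Free}(X)$ by the congruence that identifies $a$ and $b$ if and only if $a\to b$ and $b\to a$ both belong to the filter $\{g\mid f_g=1\text{ on }P\}$ (equivalently, $f_a=f_b$ on $P$). Its elements are thereby identified with the restrictions to $P$ of McNaughton functions. Write $\mathrm{Free}(k)=\mathrm{Free}(\{x_1,\dots,x_k\})$. An event in $n\ge 1$ variables is a formula built from propositional variables $x_1,\dots,x_n$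 by means of $\oplus,\neg,\bot$; an event $\varphi$ determines a function $f_\varphi:[0,1]^n\to[0,1]$. For a finite non-empty set $\mathcal E$ of events in $n$ variables let $$\mathscr C_{\mathcal E}=\overline{\mathrm{co}}\,\{(f_\varphi(x))_{\varphi\in\mathcal E}\mid x\in[0,1]^n\}\subseteq[0,1]^{\mathcal E}$$ (closed convex hull). A subset of $[0,1]^k$, $k\ge1$, is a coherent set if it equals $\mathscr C_{\mathcal E}$ for some set $\mathcal E=\{\varphi_1,\dots,\varphi_k\}$ of $k$ events in finitely many variables. An MV-algebra is coherent if it is isomorphic to $\mathrm{Free}(k)/\mathscr C$ for some $k\ge1$ and some coherent set $\mathscr C\subseteq[0,1]^k$; $\mathsf{coMV}$ is the class of coherent MV-algebras. Proposition. The class $\mathsf{coMV}$ has the joint embedding property: for all $A,B\in\mathsf{coMV}$ there exist $C\in\mathsf{coMV}$ and embeddings $A\to C$ and $B\to C$. More precisely, let $\mathcal E_1,\mathcal E_2$ be finite non-empty sets of events in $n\geq 1$ variables, and let $\mathcal E_3=\mathcal E_1\cup\mathcal E_2$. Then $\mathrm{Free}(\mathcal E_j)/\mathscr C_{\mathcal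 E_j}$ is coherent for $j=1,2,3$, and for $i=1,2$ there is an embedding $$h_i:\mathrm{Free}(\mathcal E_i)/\mathscr C_{\mathcal E_i}\to\mathrm{Free}(\mathcal E_3)/\mathscr C_{\mathcal E_3}$$ that is dual to the coordinate projection $\pi_i:\mathscr C_{\mathcal E_3}\to\mathscr C_{\mathcal E_i}$, that is, $h_i(f)=f\circ\pi_i$ when the elements of the two algebras are read as functions on $\mathscr C_{\mathcal E_i}$ and $\mathscr C_{\mathcal E_3}$; moreover $h_i([\alpha]_{\mathscr C_{\mathcal E_i}})=[\alpha]_{\mathscr C_{\mathcal E_3}}$ for all $\alpha\in\mathcal E_i$. -/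

import Mathlib

universe u v

/-- MV-algebras `(A, ⊕, ¬, ⊥)`. -/
class MVAlgebra (A : Type u) where
  oplus : A → A → A
  neg : A → A
  bot : A
  oplus_assoc : ∀ x y z, oplus (oplus x y) z = oplus x (oplus y z)
  oplus_comm : ∀ x y, oplus x y = oplus y x
  oplus_bot : ∀ x, oplus x bot = x
  neg_neg : ∀ x, neg (neg x) = x
  oplus_neg_bot : ∀ x, oplus x (neg bot) = neg bot
  luk : ∀ x y, oplus (neg (oplus (neg x) y)) y = oplus (neg (oplus (neg y) x)) x

namespace MVAlgebra

/-- `x → y := ¬x ⊕ y`. -/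
def imp {A : Type u} [MVAlgebra A] (x y : A) : A := oplus (neg x) y

/-- The standard MV-algebra on `[0,1]`: `x ⊕ y = min 1 (x + y)` and `¬x = 1 - x`. -/
noncomputable instance instUnitInterval : MVAlgebra unitInterval where
  oplus x y := ⟨min 1 ((x : ℝ) + y), le_min zero_le_one (add_nonneg x.2.1 y.2.1), min_le_left _ _⟩
  neg x := ⟨1 - (x : ℝ), sub_nonneg.2 x.2.2, sub_le_self _ x.2.1⟩
  bot := ⟨0, le_rfl, zero_le_one⟩
  oplus_assoc x y z := by
    have hx := x.2.1
    have hz := z.2.1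
    apply Subtype.ext
    simp only [min_def]
    split_ifs <;> linarith
  oplus_comm x y := by
    apply Subtype.ext
    simp only [add_comm]
  oplus_bot x := by
    apply Subtype.ext
    have hx := x.2.2
    simp [hx]
  neg_neg x := by
    apply Subtype.ext
    simp
  oplus_neg_bot x := by
    apply Subtype.ext
    have hx := x.2.1
    simp [hx]
  luk x y := by
    apply Subtype.ext
    simp only [min_def]
    split_ifs <;> linarith

end MVAlgebra

open MVAlgebra

/-- Homomorphisms of MV-algebras. -/
structure MVHom (A : Type u) (B : Type v) [MVAlgebra A] [MVAlgebra B] where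
  toFun : A → B
  map_oplus : ∀ x y, toFun (oplus x y) = oplus (toFun x) (toFun y)
  map_neg : ∀ x, toFun (neg x) = neg (toFun x)
  map_bot : toFun bot = bot

/-- Formulas of Łukasiewicz logic (that is, MV-terms) with propositional variables in `X`. -/
inductive Formula (X : Type) : Type where
  | var : X → Formula X
  | bot : Formula X
  | neg : Formula X → Formula X
  | oplus : Formula X → Formula X → Formula X

namespace Formula

variable {X : Type}

/-- The value of a formula in an MV-algebra under a valuation of the variables. -/
def eval {A : Type u} [MVAlgebra A] (v : X → A) : Formula X → A
  | var x => v x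
  | bot => MVAlgebra.bot
  | neg s => MVAlgebra.neg (eval v s)
  | oplus s t => MVAlgebra.oplus (eval v s) (eval v t)

/-- Derivability of identities in equational logic from the axioms of MV-algebras. -/
inductive Equiv : Formula X → Formula X → Prop where
  | refl (s) : Equiv s s
  | symm {s t} : Equiv s t → Equiv t s
  | trans {s t r} : Equiv s t → Equiv t r → Equiv s r
  | congr_neg {s t} : Equiv s t → Equiv (neg s) (neg t)
  | congr_oplus {s s' t t'} : Equiv s s' → Equiv t t' → Equiv (oplus s t) (oplus s' t')
  | oplus_assoc (s t r) : Equiv (oplus (oplus s t) r) (oplus s (oplus t r))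
  | oplus_comm (s t) : Equiv (oplus s t) (oplus t s)
  | oplus_bot (s) : Equiv (oplus s bot) s
  | neg_neg (s) : Equiv (neg (neg s)) s
  | oplus_neg_bot (s) : Equiv (oplus s (neg bot)) (neg bot)
  | luk (s t) : Equiv (oplus (neg (oplus (neg s) t)) t) (oplus (neg (oplus (neg t) s)) s)

theorem Equiv.eval_eq {A : Type u} [MVAlgebra A] (v : X → A) {s t : Formula X}
    (h : Equiv s t) : s.eval v = t.eval v := by
  induction h with
  | refl _ => rfl
  | symm _ ih => exact ih.symm
  | trans _ _ ih₁ ih₂ => exact ih₁.trans ih₂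
  | congr_neg _ ih => simp only [eval, ih]
  | congr_oplus _ _ ih₁ ih₂ => simp only [eval, ih₁, ih₂]
  | oplus_assoc _ _ _ => exact MVAlgebra.oplus_assoc _ _ _
  | oplus_comm _ _ => exact MVAlgebra.oplus_comm _ _
  | oplus_bot _ => exact MVAlgebra.oplus_bot _
  | neg_neg _ => exact MVAlgebra.neg_neg _
  | oplus_neg_bot _ => exact MVAlgebra.oplus_neg_bot _
  | luk _ _ => exact MVAlgebra.luk _ _

/-- Provable equality as an equivalence relation. -/
def setoid (X : Type) : Setoid (Formula X) := ⟨Equiv, Equiv.refl, Equiv.symm, Equiv.trans⟩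

end Formula

/-- The free MV-algebra `Free(X)`: formulas modulo the identities of MV-algebras. -/
def FreeMV (X : Type) : Type := Quotient (Formula.setoid X)

namespace FreeMV

variable {X : Type}

/-- The free generator given by `x`. -/
def var (x : X) : FreeMV X := Quotient.mk (Formula.setoid X) (Formula.var x)

instance instMVAlgebra : MVAlgebra (FreeMV X) where
  oplus := Quotient.map₂ Formula.oplus fun _ _ h _ _ h' => Formula.Equiv.congr_oplus h h'
  neg := Quotient.map Formula.neg fun _ _ h => Formula.Equiv.congr_neg h
  bot := Quotient.mk _ Formula.bot
  oplus_assoc := by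
    rintro ⟨s⟩ ⟨t⟩ ⟨r⟩
    exact Quotient.sound (Formula.Equiv.oplus_assoc s t r)
  oplus_comm := by
    rintro ⟨s⟩ ⟨t⟩
    exact Quotient.sound (Formula.Equiv.oplus_comm s t)
  oplus_bot := by
    rintro ⟨s⟩
    exact Quotient.sound (Formula.Equiv.oplus_bot s)
  neg_neg := by
    rintro ⟨s⟩
    exact Quotient.sound (Formula.Equiv.neg_neg s)
  oplus_neg_bot := by
    rintro ⟨s⟩
    exact Quotient.sound (Formula.Equiv.oplus_neg_bot s)
  luk := by
    rintro ⟨s⟩ ⟨t⟩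
    exact Quotient.sound (Formula.Equiv.luk s t)

/-- The homomorphism on `Free(X)` that extends `v : X → A`. -/
def lift {A : Type u} [MVAlgebra A] (v : X → A) : MVHom (FreeMV X) A where
  toFun := Quotient.lift (Formula.eval v) fun _ _ h => Formula.Equiv.eval_eq v h
  map_oplus := by
    rintro ⟨s⟩ ⟨t⟩
    rfl
  map_neg := by
    rintro ⟨s⟩
    rfl
  map_bot := rfl

/-- The universal property of `Free(X)`. -/
theorem lift_unique {A : Type u} [MVAlgebra A] (v : X → A) :
    (∀ x, (lift v).toFun (var x) = v x) ∧
      ∀ h : MVHom (FreeMV X) A, (∀ x, h.toFun (var x) = v x) →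
        ∀ a, h.toFun a = (lift v).toFun a := by
  refine ⟨fun _ => rfl, fun h hv => ?_⟩
  rintro ⟨s⟩
  induction s with
  | var x => exact hv x
  | bot => exact h.map_bot
  | neg s ih => exact (h.map_neg _).trans (congrArg neg ih)
  | oplus s t ih₁ ih₂ => exact (h.map_oplus _ _).trans (congrArg₂ oplus ih₁ ih₂)

/-- The McNaughton function `f_a : [0,1]^X → [0,1]` of an element `a` of `Free(X)`. -/
noncomputable def mcNaughton (a : FreeMV X) (x : X → unitInterval) : unitInterval :=
  (lift x).toFun a

/-- The oneset `O(a)` of the McNaughton function of `a`. -/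
def oneset (a : FreeMV X) : Set (X → unitInterval) := {x | a.mcNaughton x = 1}

/-- The filter `F_P` of all `a` whose oneset contains `P`. -/
def filterOf (P : Set (X → unitInterval)) : Set (FreeMV X) := {a | P ⊆ a.oneset}

theorem imp_mcNaughton_eq_one (a b : FreeMV X) (x : X → unitInterval) :
    (imp a b).mcNaughton x = 1 ↔ a.mcNaughton x ≤ b.mcNaughton x := by
  have h : (imp a b).mcNaughton x = imp (a.mcNaughton x) (b.mcNaughton x) := by
    simp only [mcNaughton, imp, (lift x).map_oplus, (lift x).map_neg]
  rw [h, Subtype.ext_iff, ← Subtype.coe_le_coe]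
  change min 1 (1 - (a.mcNaughton x : ℝ) + b.mcNaughton x) = 1 ↔ _
  rw [min_eq_left_iff]
  constructor <;> intro h <;> linarith

/-- `a → b` and `b → a` lie in `F_P` if and only if the McNaughton functions of `a` and `b`
agree on `P`. -/
theorem mem_filterOf_iff (P : Set (X → unitInterval)) (a b : FreeMV X) :
    (imp a b ∈ filterOf P ∧ imp b a ∈ filterOf P) ↔
      ∀ x ∈ P, a.mcNaughton x = b.mcNaughton x := by
  constructor
  · rintro ⟨h₁, h₂⟩ x hx
    exact le_antisymm ((imp_mcNaughton_eq_one a b x).1 (h₁ hx))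
      ((imp_mcNaughton_eq_one b a x).1 (h₂ hx))
  · intro h
    exact ⟨fun x hx => (imp_mcNaughton_eq_one a b x).2 (h x hx).le,
      fun x hx => (imp_mcNaughton_eq_one b a x).2 (h x hx).ge⟩

/-- The congruence of `Free(X)` that corresponds to the filter `F_P`. -/
def congruence (P : Set (X → unitInterval)) : Setoid (FreeMV X) where
  r a b := imp a b ∈ filterOf P ∧ imp b a ∈ filterOf P
  iseqv := by
    simp only [mem_filterOf_iff]
    exact ⟨fun _ _ _ => rfl, fun h x hx => (h x hx).symm,
      fun h h' x hx => (h x hx).trans (h' x hx)⟩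

end FreeMV

/-- The quotient `Free(X)/P`. -/
def FreeQuot {X : Type} (P : Set (X → unitInterval)) : Type :=
  Quotient (FreeMV.congruence P)

namespace FreeQuot

variable {X : Type} {P : Set (X → unitInterval)}

/-- The class `[a]_P` of `a`. -/
def mk (P : Set (X → unitInterval)) (a : FreeMV X) : FreeQuot P :=
  Quotient.mk (FreeMV.congruence P) a

instance instMVAlgebra : MVAlgebra (FreeQuot P) where
  oplus := Quotient.map₂ oplus fun a a' h b b' h' =>
    (FreeMV.mem_filterOf_iff P _ _).2 fun x hx => by
      have h₁ := (FreeMV.mem_filterOf_iff P a a').1 h x hx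
      have h₂ := (FreeMV.mem_filterOf_iff P b b').1 h' x hx
      simp only [FreeMV.mcNaughton, MVHom.map_oplus] at h₁ h₂ ⊢
      rw [h₁, h₂]
  neg := Quotient.map neg fun a a' h =>
    (FreeMV.mem_filterOf_iff P _ _).2 fun x hx => by
      have h₁ := (FreeMV.mem_filterOf_iff P a a').1 h x hx
      simp only [FreeMV.mcNaughton, MVHom.map_neg] at h₁ ⊢
      rw [h₁]
  bot := mk P bot
  oplus_assoc := by
    rintro ⟨a⟩ ⟨b⟩ ⟨c⟩
    exact congrArg (mk P) (oplus_assoc a b c)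
  oplus_comm := by
    rintro ⟨a⟩ ⟨b⟩
    exact congrArg (mk P) (oplus_comm a b)
  oplus_bot := by
    rintro ⟨a⟩
    exact congrArg (mk P) (oplus_bot a)
  neg_neg := by
    rintro ⟨a⟩
    exact congrArg (mk P) (neg_neg a)
  oplus_neg_bot := by
    rintro ⟨a⟩
    exact congrArg (mk P) (oplus_neg_bot a)
  luk := by
    rintro ⟨a⟩ ⟨b⟩
    exact congrArg (mk P) (luk a b)

/-- An element of `Free(X)/P` read as a function on `P`: the class of `a` is read as the
restriction to `P` of the McNaughton function of `a`. -/
noncomputable def toFunction (c : FreeQuot P) (x : P) : unitInterval :=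
  Quotient.lift (fun a : FreeMV X => a.mcNaughton x)
    (fun a b h => (FreeMV.mem_filterOf_iff P a b).1 h x x.2) c

/-- `h : Free(X)/P → Free(Y)/Q` is dual to the map `η : Q → P`: on functions, `h` is
composition with `η`. -/
def IsDual {Y : Type} {Q : Set (Y → unitInterval)} (η : Q → P)
    (h : MVHom (FreeQuot P) (FreeQuot Q)) : Prop :=
  ∀ (c : FreeQuot P) (y : Q), (h.toFun c).toFunction y = c.toFunction (η y)

end FreeQuot

/-- The vectors `⟨f_{φ i}(x)⟩_i`, for `x ∈ [0,1]^n`, of values of the McNaughton functions of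
a family `φ` of events in `n` variables. -/
def eventValues {n : ℕ} {ι : Type} (φ : ι → Formula (Fin n)) : Set (ι → ℝ) :=
  Set.range fun (x : Fin n → unitInterval) (i : ι) => (((φ i).eval x : unitInterval) : ℝ)

/-- The closed convex hull of `eventValues φ`, as a subset of the cube `[0,1]^ι`. -/
def coherentSet {n : ℕ} {ι : Type} (φ : ι → Formula (Fin n)) : Set (ι → unitInterval) :=
  {β | (fun i => (β i : ℝ)) ∈ closedConvexHull ℝ (eventValues φ)}

/-- Nothing is lost by intersecting with the cube. -/
theorem image_coherentSet {n : ℕ} {ι : Type} (φ : ι → Formula (Fin n)) :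
    (fun (β : ι → unitInterval) i => (β i : ℝ)) '' coherentSet φ =
      closedConvexHull ℝ (eventValues φ) := by
  apply Set.Subset.antisymm
  · rintro _ ⟨β, hβ, rfl⟩
    exact hβ
  · intro y hy
    have hcube : closedConvexHull ℝ (eventValues φ) ⊆ Set.univ.pi fun _ => Set.Icc (0 : ℝ) 1 := by
      apply closedConvexHull_min
      · rintro _ ⟨x, rfl⟩ i -
        exact ((φ i).eval x).2
      · exact convex_pi fun _ _ => convex_Icc 0 1
      · exact isClosed_set_pi fun _ _ => isClosed_Icc
    exact ⟨fun i => ⟨y i, hcube hy i trivial⟩, hy, rfl⟩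

/-- `C_E ⊆ [0,1]^E` for a set `E` of events in `n` variables. -/
def coherentSetOf {n : ℕ} (E : Set (Formula (Fin n))) : Set (E → unitInterval) :=
  coherentSet (Subtype.val : E → Formula (Fin n))

/-- The coordinate projection `[0,1]^{E'} → [0,1]^E`, for `E ⊆ E'`, maps `C_{E'}` into
`C_E`. -/
theorem restrict_mem {n : ℕ} {E E' : Set (Formula (Fin n))} (h : E ⊆ E')
    (β : E' → unitInterval) (hβ : β ∈ coherentSetOf E') :
    (fun α : E => β ⟨α.1, h α.2⟩) ∈ coherentSetOf E := by
  let L : (E' → ℝ) →ₗ[ℝ] (E → ℝ) := LinearMap.funLeft ℝ ℝ (Set.inclusion h)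
  have hL : Continuous L := continuous_pi fun α => continuous_apply _
  have key : closedConvexHull ℝ (eventValues (Subtype.val : E' → Formula (Fin n))) ⊆
      L ⁻¹' closedConvexHull ℝ (eventValues (Subtype.val : E → Formula (Fin n))) := by
    apply closedConvexHull_min
    · rintro _ ⟨x, rfl⟩
      exact subset_closedConvexHull ⟨x, rfl⟩
    · exact convex_closedConvexHull.linear_preimage L
    · exact isClosed_closedConvexHull.preimage hL
  exact key hβ

/-- The coordinate projection `[0,1]^{E'} → [0,1]^E`, for `E ⊆ E'`, as a map
`C_{E'} → C_E`. -/
def projection {n : ℕ} {E E' : Set (Formula (Fin n))} (h : E ⊆ E')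
    (β : coherentSetOf E') : coherentSetOf E :=
  ⟨fun α => β.1 ⟨α.1, h α.2⟩, restrict_mem h β.1 β.2⟩

/-- `C ⊆ [0,1]^k` is a coherent set: `C = C_E` for a set `E = {φ 0, …, φ (k-1)}` of `k` events
in finitely many variables. -/
def IsCoherentSet {k : ℕ} (C : Set (Fin k → unitInterval)) : Prop :=
  ∃ (n : ℕ) (φ : Fin k → Formula (Fin n)), 0 < n ∧ Function.Injective φ ∧ C = coherentSet φ

/-- Coherent MV-algebras: those isomorphic to `Free(k)/C` with `k` a positive integer and `C`
a coherent subset of `[0,1]^k`. -/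
def IsCoherentMV (A : Type u) [MVAlgebra A] : Prop :=
  ∃ (k : ℕ) (C : Set (Fin k → unitInterval)), 0 < k ∧ IsCoherentSet C ∧
    ∃ f : MVHom (FreeQuot C) A, Function.Bijective f.toFun

/-- The joint embedding property of a class of MV-algebras. -/
def JointEmbeddingProperty (K : ∀ (A : Type u) [MVAlgebra A], Prop) : Prop :=
  ∀ (A B : Type u) [MVAlgebra A] [MVAlgebra B], K A → K B →
    ∃ (C : Type u) (_ : MVAlgebra C), K C ∧
      (∃ h : MVHom A C, Function.Injective h.toFun) ∧
      ∃ h : MVHom B C, Function.Injective h.toFun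

/-! A map of generators `σ : X → Y` induces a homomorphism of free algebras that acts on McNaughton
functions by precomposition with `y ↦ y ∘ σ`. It descends to the quotients by `P` and `Q` when this
coordinate map sends `Q` into `P`, and the descended map is injective when the image is all of `P`.
So every embedding here reduces to one geometric fact, `image_comp_coherentSet`: a coordinate map is
linear and continuous and the hulls are compact, so hulls map onto hulls as soon as the generating
value sets do. This is applied to an enumeration of a finite set of events (coherence), to an
inclusion of sets of events (the dual of the projection), and to a renaming of variables. The last
gives joint embedding: by `eventValues_rename` two families of events can be moved into common
variables without changing their values, and then their union is taken. -/

/-- The composite of two homomorphisms of MV-algebras. -/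
def MVHom.comp {A B C : Type*} [MVAlgebra A] [MVAlgebra B] [MVAlgebra C]
    (g : MVHom B C) (f : MVHom A B) : MVHom A C where
  toFun := g.toFun ∘ f.toFun
  map_oplus x y := by simp only [Function.comp_apply, f.map_oplus, g.map_oplus]
  map_neg x := by simp only [Function.comp_apply, f.map_neg, g.map_neg]
  map_bot := by simp only [Function.comp_apply, f.map_bot, g.map_bot]

/-- The inverse of a bijective homomorphism. -/
theorem MVHom.exists_inverse {A B : Type*} [MVAlgebra A] [MVAlgebra B] (f : MVHom A B)
    (hf : Function.Bijective f.toFun) : ∃ g : MVHom B A, Function.Injective g.toFun := by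
  let e := _root_.Equiv.ofBijective f.toFun hf
  have he : ∀ a, f.toFun a = e a := fun _ => rfl
  refine ⟨⟨e.symm, fun x y => ?_, fun x => ?_, ?_⟩, e.symm.injective⟩
  · rw [e.symm_apply_eq, ← he, f.map_oplus, he, he, e.apply_symm_apply, e.apply_symm_apply]
  · rw [e.symm_apply_eq, ← he, f.map_neg, he, e.apply_symm_apply]
  · rw [e.symm_apply_eq, ← he, f.map_bot]

/-- The quotients of free algebras live in `Type`, whereas joint embedding is asserted in `Type u`.
-/
instance instMVAlgebraULift {A : Type v} [MVAlgebra A] : MVAlgebra (ULift.{u} A) where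
  oplus x y := ⟨oplus x.down y.down⟩
  neg x := ⟨neg x.down⟩
  bot := ⟨bot⟩
  oplus_assoc _ _ _ := congrArg ULift.up (oplus_assoc _ _ _)
  oplus_comm _ _ := congrArg ULift.up (oplus_comm _ _)
  oplus_bot _ := congrArg ULift.up (oplus_bot _)
  neg_neg _ := congrArg ULift.up (neg_neg _)
  oplus_neg_bot _ := congrArg ULift.up (oplus_neg_bot _)
  luk _ _ := congrArg ULift.up (luk _ _)

/-- The isomorphism from an MV-algebra onto its lift to a higher universe. -/
def MVHom.up (A : Type v) [MVAlgebra A] : MVHom A (ULift.{u} A) where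
  toFun := ULift.up
  map_oplus _ _ := rfl
  map_neg _ := rfl
  map_bot := rfl

theorem MVHom.up_bijective (A : Type v) [MVAlgebra A] :
    Function.Bijective (MVHom.up.{u} A).toFun :=
  ⟨ULift.up_injective, ULift.up_surjective⟩

theorem IsCoherentMV.of_bijective {A : Type u} {B : Type v} [MVAlgebra A] [MVAlgebra B]
    (hA : IsCoherentMV A) (g : MVHom A B) (hg : Function.Bijective g.toFun) :
    IsCoherentMV B := by
  obtain ⟨k, C, hk, hC, f, hf⟩ := hA
  exact ⟨k, C, hk, hC, g.comp f, hg.comp hf⟩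

/-! ### Homomorphisms induced by maps of variables -/

namespace Formula

/-- Renaming of the variables of a formula. -/
def rename {X Y : Type} (σ : X → Y) : Formula X → Formula Y
  | var x => var (σ x)
  | bot => bot
  | neg s => neg (rename σ s)
  | oplus s t => oplus (rename σ s) (rename σ t)

theorem eval_rename {X Y : Type} {A : Type*} [MVAlgebra A] (σ : X → Y) (v : Y → A)
    (s : Formula X) : (s.rename σ).eval v = s.eval (v ∘ σ) := by
  induction s with
  | var x => rfl
  | bot => rfl
  | neg s ih => simp only [rename, eval, ih]
  | oplus s t ih₁ ih₂ => simp only [rename, eval, ih₁, ih₂]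

end Formula

namespace FreeMV

variable {X Y : Type}

/-- The homomorphism between free MV-algebras that is induced by a map of generators. -/
def map (σ : X → Y) : MVHom (FreeMV X) (FreeMV Y) := lift fun x => var (σ x)

/-- Both sides are homomorphisms in `a` that agree on the generators. -/
theorem mcNaughton_map (σ : X → Y) (a : FreeMV X) (y : Y → unitInterval) :
    ((map σ).toFun a).mcNaughton y = a.mcNaughton (y ∘ σ) :=
  (lift_unique (y ∘ σ)).2 ((lift y).comp (map σ)) (fun _ => rfl) a

theorem map_surjective {σ : X → Y} (hσ : Function.Surjective σ) :
    Function.Surjective (map σ).toFun := by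
  obtain ⟨τ, hτ⟩ := hσ.hasRightInverse
  intro b
  refine ⟨(map τ).toFun b, ?_⟩
  -- The composite and the identity both fix the generators, so both equal `lift var`.
  have h₁ := (lift_unique (A := FreeMV Y) var).2 ((map σ).comp (map τ))
    (fun y => congrArg var (hτ y)) b
  have h₂ := (lift_unique (A := FreeMV Y) var).2
    ⟨id, fun _ _ => rfl, fun _ => rfl, rfl⟩ (fun _ => rfl) b
  exact h₁.trans h₂.symm

end FreeMV

namespace FreeQuot

variable {X Y : Type} {P : Set (X → unitInterval)} {Q : Set (Y → unitInterval)}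

/-- The homomorphism `Free(X)/P → Free(Y)/Q` that is induced by a map of generators whose dual
map sends `Q` into `P`. -/
def map (σ : X → Y) (h : Set.MapsTo (· ∘ σ) Q P) : MVHom (FreeQuot P) (FreeQuot Q) where
  toFun := Quotient.map (FreeMV.map σ).toFun fun a b hab =>
    (FreeMV.mem_filterOf_iff Q _ _).2 fun y hy => by
      rw [FreeMV.mcNaughton_map, FreeMV.mcNaughton_map]
      exact (FreeMV.mem_filterOf_iff P a b).1 hab _ (h hy)
  map_oplus := by
    rintro ⟨a⟩ ⟨b⟩
    exact congrArg (mk Q) ((FreeMV.map σ).map_oplus a b)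
  map_neg := by
    rintro ⟨a⟩
    exact congrArg (mk Q) ((FreeMV.map σ).map_neg a)
  map_bot := congrArg (mk Q) (FreeMV.map σ).map_bot

theorem toFunction_map (σ : X → Y) (h : Set.MapsTo (· ∘ σ) Q P) (c : FreeQuot P) (y : Q) :
    ((map σ h).toFun c).toFunction y = c.toFunction ⟨y.1 ∘ σ, h y.2⟩ := by
  obtain ⟨a⟩ := c
  exact FreeMV.mcNaughton_map σ a y

theorem toFunction_injective : Function.Injective (toFunction : FreeQuot P → P → unitInterval) := by
  rintro ⟨a⟩ ⟨b⟩ hab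
  exact Quotient.sound ((FreeMV.mem_filterOf_iff P a b).2 fun x hx => congrFun hab ⟨x, hx⟩)

/-- Elements with equal images agree as functions at each point `y ∘ σ` with `y ∈ Q`, and these
points exhaust `P`. -/
theorem map_injective (σ : X → Y) (h : Set.MapsTo (· ∘ σ) Q P)
    (hs : Set.SurjOn (· ∘ σ) Q P) : Function.Injective (map σ h).toFun := by
  intro c d hcd
  apply toFunction_injective
  funext ⟨x, hx⟩
  obtain ⟨y, hy, rfl⟩ := hs hx
  rw [← toFunction_map σ h c ⟨y, hy⟩, ← toFunction_map σ h d ⟨y, hy⟩, hcd]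

theorem map_surjective {σ : X → Y} (hσ : Function.Surjective σ)
    (h : Set.MapsTo (· ∘ σ) Q P) : Function.Surjective (map σ h).toFun := by
  rintro ⟨b⟩
  obtain ⟨a, rfl⟩ := FreeMV.map_surjective hσ b
  exact ⟨mk P a, rfl⟩

end FreeQuot

/-! ### Coordinate images of coherent sets -/

/-- If the values of the events `φ` are obtained from those of the events `ψ` by a coordinate
map, then so is the coherent set of `φ` from that of `ψ`. -/
theorem image_comp_coherentSet {m n : ℕ} {ι κ : Type} [Finite κ]
    {φ : ι → Formula (Fin m)} {ψ : κ → Formula (Fin n)} (σ : ι → κ)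
    (h : (fun x : κ → ℝ => x ∘ σ) '' eventValues ψ = eventValues φ) :
    (fun x : κ → unitInterval => x ∘ σ) '' coherentSet ψ = coherentSet φ := by
  let L : (κ → ℝ) →ₗ[ℝ] (ι → ℝ) := LinearMap.funLeft ℝ ℝ σ
  have hL : Continuous L := continuous_pi fun i => continuous_apply _
  have hLσ : L '' eventValues ψ = eventValues φ := h
  -- A linear image of a closed set need not be closed; that of a compact set is.
  have hcompact : IsCompact (closedConvexHull ℝ (eventValues ψ)) := by
    refine (isCompact_univ_pi fun _ : κ => isCompact_Icc (a := (0 : ℝ)) (b := 1)).of_isClosed_subset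
      isClosed_closedConvexHull ?_
    rw [← image_coherentSet]
    rintro _ ⟨β, -, rfl⟩ i -
    exact (β i).2
  have key : L '' closedConvexHull ℝ (eventValues ψ) = closedConvexHull ℝ (eventValues φ) := by
    apply Set.Subset.antisymm
    · rw [Set.image_subset_iff]
      apply closedConvexHull_min
      · rw [← Set.image_subset_iff, hLσ]
        exact subset_closedConvexHull
      · exact convex_closedConvexHull.linear_preimage L
      · exact isClosed_closedConvexHull.preimage hL
    -- The image of the hull is convex, closed by compactness, and contains the values of `φ`.
    · apply closedConvexHull_min
      · rw [← hLσ]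
        exact Set.image_mono subset_closedConvexHull
      · exact convex_closedConvexHull.linear_image L
      · exact (hcompact.image hL).isClosed
  apply Set.Subset.antisymm
  · rintro _ ⟨β, hβ, rfl⟩
    exact key.subset ⟨_, hβ, rfl⟩
  · intro γ hγ
    obtain ⟨y, hy, hyγ⟩ := key.superset hγ
    -- The preimage is a real vector; this places it in the cube.
    rw [← image_coherentSet] at hy
    obtain ⟨β, hβ, rfl⟩ := hy
    exact ⟨β, hβ, funext fun i => Subtype.ext (congrFun hyγ i)⟩

theorem image_comp_eventValues {n : ℕ} {ι κ : Type} (ψ : κ → Formula (Fin n)) (σ : ι → κ) :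
    (fun x : κ → ℝ => x ∘ σ) '' eventValues ψ = eventValues (ψ ∘ σ) :=
  (Set.range_comp _ _).symm

/-- Since `τ` is injective, every valuation of the old variables extends to the new ones. -/
theorem eventValues_rename {m n : ℕ} {ι : Type} (φ : ι → Formula (Fin m)) {τ : Fin m → Fin n}
    (hτ : Function.Injective τ) :
    eventValues (fun i => (φ i).rename τ) = eventValues φ := by
  simp only [eventValues, Formula.eval_rename]
  exact hτ.surjective_comp_right.range_comp
    fun (x : Fin m → unitInterval) (i : ι) => (((φ i).eval x : unitInterval) : ℝ)

/-! ### Coherence and embeddings -/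

theorem isCoherentMV_freeQuot_coherentSetOf {n : ℕ} (hn : 0 < n) {E : Set (Formula (Fin n))}
    (hE : E.Finite) (hne : E.Nonempty) : IsCoherentMV (FreeQuot (coherentSetOf E)) := by
  have := hE.to_subtype
  have := hne.to_subtype
  -- Enumerating `E` without repetition turns the index set into `Fin k`; the induced map is an
  -- isomorphism.
  let e := (Finite.equivFin E).symm
  have himage := image_comp_coherentSet (φ := Subtype.val ∘ e) e
    (image_comp_eventValues (Subtype.val : E → Formula (Fin n)) e)
  refine ⟨Nat.card E, coherentSet (Subtype.val ∘ e), Nat.card_pos,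
    ⟨n, _, hn, Subtype.val_injective.comp e.injective, rfl⟩,
    FreeQuot.map e (Set.mapsTo_iff_image_subset.2 himage.subset),
    FreeQuot.map_injective _ _ himage.superset, FreeQuot.map_surjective e.surjective _⟩

/-- The embedding dual to a coordinate projection between coherent sets. -/
theorem exists_embedding_dual_projection {n : ℕ} {E E' : Set (Formula (Fin n))} (h : E ⊆ E')
    (hE' : E'.Finite) :
    ∃ f : MVHom (FreeQuot (coherentSetOf E)) (FreeQuot (coherentSetOf E')),
      FreeQuot.IsDual (projection h) f ∧ Function.Injective f.toFun ∧
      ∀ (α : Formula (Fin n)) (hα : α ∈ E),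
        f.toFun (FreeQuot.mk (coherentSetOf E) (FreeMV.var ⟨α, hα⟩)) =
          FreeQuot.mk (coherentSetOf E') (FreeMV.var ⟨α, h hα⟩) := by
  have := hE'.to_subtype
  have himage := image_comp_coherentSet (φ := (Subtype.val : E → Formula (Fin n)))
    (Set.inclusion h) (image_comp_eventValues (Subtype.val : E' → Formula (Fin n)) _)
  exact ⟨FreeQuot.map (Set.inclusion h) (Set.mapsTo_iff_image_subset.2 himage.subset),
    FreeQuot.toFunction_map _ _, FreeQuot.map_injective _ _ himage.superset, fun _ _ => rfl⟩

/-- The algebra of events `φ` embeds into that of every finite set that contains the events `φ`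
with renamed variables. -/
theorem exists_embedding_of_rename {m n : ℕ} {ι : Type} (φ : ι → Formula (Fin m))
    {τ : Fin m → Fin n} (hτ : Function.Injective τ) {E : Set (Formula (Fin n))} (hE : E.Finite)
    (h : ∀ i, (φ i).rename τ ∈ E) :
    ∃ f : MVHom (FreeQuot (coherentSet φ)) (FreeQuot (coherentSetOf E)),
      Function.Injective f.toFun := by
  have := hE.to_subtype
  -- This index map need not be injective: distinct indices may name the same event.
  have himage := image_comp_coherentSet (φ := φ) (fun i => (⟨(φ i).rename τ, h i⟩ : E))
    ((image_comp_eventValues (Subtype.val : E → Formula (Fin n)) _).trans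
      (eventValues_rename φ hτ))
  exact ⟨FreeQuot.map _ (Set.mapsTo_iff_image_subset.2 himage.subset),
    FreeQuot.map_injective _ _ himage.superset⟩

theorem jointEmbeddingProperty_isCoherentMV :
    JointEmbeddingProperty.{u} (fun A [MVAlgebra A] => IsCoherentMV A) := by
  rintro A B _ _ ⟨k₁, _, hk₁, ⟨n₁, φ₁, hn₁, -, rfl⟩, f₁, hf₁⟩
    ⟨k₂, _, -, ⟨n₂, φ₂, -, -, rfl⟩, f₂, hf₂⟩
  -- The two families use separate blocks of the `n₁ + n₂` variables.
  let ψ₁ : Fin k₁ → Formula (Fin (n₁ + n₂)) := fun i => (φ₁ i).rename (Fin.castAdd n₂)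
  let ψ₂ : Fin k₂ → Formula (Fin (n₁ + n₂)) := fun i => (φ₂ i).rename (Fin.natAdd n₁)
  have hE : (Set.range ψ₁ ∪ Set.range ψ₂).Finite :=
    (Set.finite_range ψ₁).union (Set.finite_range ψ₂)
  obtain ⟨g₁, hg₁⟩ := f₁.exists_inverse hf₁
  obtain ⟨g₂, hg₂⟩ := f₂.exists_inverse hf₂
  obtain ⟨h₁, hh₁⟩ := exists_embedding_of_rename φ₁ (Fin.castAdd_injective n₁ n₂) hE
    fun i => Or.inl ⟨i, rfl⟩
  obtain ⟨h₂, hh₂⟩ := exists_embedding_of_rename φ₂ (Fin.natAdd_injective n₂ n₁) hE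
    fun i => Or.inr ⟨i, rfl⟩
  have hup := MVHom.up_bijective.{u} (FreeQuot (coherentSetOf (Set.range ψ₁ ∪ Set.range ψ₂)))
  exact ⟨ULift.{u} (FreeQuot (coherentSetOf (Set.range ψ₁ ∪ Set.range ψ₂))), inferInstance,
    (isCoherentMV_freeQuot_coherentSetOf (by omega) hE ⟨ψ₁ ⟨0, hk₁⟩, Or.inl ⟨_, rfl⟩⟩).of_bijective
      _ hup,
    ⟨(MVHom.up _).comp (h₁.comp g₁), hup.injective.comp (hh₁.comp hg₁)⟩,
    ⟨(MVHom.up _).comp (h₂.comp g₂), hup.injective.comp (hh₂.comp hg₂)⟩⟩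

theorem mainTheorem10 :
    JointEmbeddingProperty.{u} (fun A [MVAlgebra A] => IsCoherentMV A) ∧
    ∀ (n : ℕ) (E₁ E₂ : Set (Formula (Fin n))), 0 < n →
      E₁.Finite → E₁.Nonempty → E₂.Finite → E₂.Nonempty →
      IsCoherentMV (FreeQuot (coherentSetOf E₁)) ∧
      IsCoherentMV (FreeQuot (coherentSetOf E₂)) ∧
      IsCoherentMV (FreeQuot (coherentSetOf (E₁ ∪ E₂))) ∧
      (∃ h₁ : MVHom (FreeQuot (coherentSetOf E₁)) (FreeQuot (coherentSetOf (E₁ ∪ E₂))),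
        FreeQuot.IsDual (projection Set.subset_union_left) h₁ ∧
        Function.Injective h₁.toFun ∧
        ∀ (α : Formula (Fin n)) (hα : α ∈ E₁),
          h₁.toFun (FreeQuot.mk (coherentSetOf E₁) (FreeMV.var ⟨α, hα⟩)) =
            FreeQuot.mk (coherentSetOf (E₁ ∪ E₂)) (FreeMV.var ⟨α, Or.inl hα⟩)) ∧
      (∃ h₂ : MVHom (FreeQuot (coherentSetOf E₂)) (FreeQuot (coherentSetOf (E₁ ∪ E₂))),
        FreeQuot.IsDual (projection Set.subset_union_right) h₂ ∧
        Function.Injective h₂.toFun ∧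
        ∀ (α : Formula (Fin n)) (hα : α ∈ E₂),
          h₂.toFun (FreeQuot.mk (coherentSetOf E₂) (FreeMV.var ⟨α, hα⟩)) =
            FreeQuot.mk (coherentSetOf (E₁ ∪ E₂)) (FreeMV.var ⟨α, Or.inr hα⟩)) := by
  refine ⟨jointEmbeddingProperty_isCoherentMV, fun n E₁ E₂ hn hE₁ hne₁ hE₂ hne₂ => ?_⟩
  have hE := hE₁.union hE₂
  exact ⟨isCoherentMV_freeQuot_coherentSetOf hn hE₁ hne₁,
    isCoherentMV_freeQuot_coherentSetOf hn hE₂ hne₂,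
    isCoherentMV_freeQuot_coherentSetOf hn hE hne₁.inl,
    exists_embedding_dual_projection Set.subset_union_left hE,
    exists_embedding_dual_projection Set.subset_union_right hE⟩
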